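/- **Theorem.** Let $n\ge 2$ and $N=n^2$, and regard $M_n\otimes M_n$, where $M_n=M_n(\mathbb C)$, as the full matrix algebra $M_N$. By a subalgebra we mean a unital $*$-subalgebra. Subalgebras $\mathcal A,\mathcal B$ are called complementary if $\operatorname{Tr}(A^*B)=0$ for all $A\in\mathcal A$, $B\in\mathcal B$ with $\operatorname{Tr}A=\operatorname{Tr}B=0$. A subalgebra of $M_n\otimes M_n$ is an F-subalgebra if it is $*$-isomorphic to $M_n$, and an M-subalgebra if it is a maximal Abelian subalgebra. Let $\mathcal A_1,\dots,\mathcal A_{n^2+1}$ be pairwise complementary subalgebras of $M_n\otimes M_n$ whose linear span is $M_n\otimes M_n$, each of which is an F-subalgebra or an M-subalgebra. Let $E_i$ be the trace-preserving conditional expectation of $M_n\otimes M_n$ onto $\mathcal A_i$, that is, the orthogonal projection onto $\mathcal A_i$ with respect to the Hilbert–Schmidt inner product $\langle A,B\rangle=\operatorname{Tr}A^*B$. For $\lambda_1,\dots,\lambda_{n^2+1}\in\mathbb R$ let $$\alpha(A)=\Big(1-\sum_{i=1}^{n^2+1}\lambda_i\Big)\frac{\operatorname{Tr}A}{n^2}\,I+\sum_{i=1}^{n^2+1}\lambda_iE_i(A)\qquad(A\in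 M_n\otimes M_n),$$ so that $\alpha$ is linear, unital and trace-preserving and $\alpha(B)=\sum_i\lambda_iE_i(B)$ whenever $\operatorname{Tr}B=0$. Then $\alpha$ is completely positive if and only if $$1+n^2\lambda_i\ \ge\ \sum_{j=1}^{n^2+1}\lambda_j\ \ge\ -\frac1{n^2-1}\qquad\text{for every }1\le i\le n^2+1.$$ -/

import Mathlib

namespace PauliChannel

/-- Two unital `*`-subalgebras of a full matrix algebra are complementary (quasi-orthogonal) if
`A ⊖ ℂI` and `B ⊖ ℂI` are orthogonal for the Hilbert-Schmidt inner product `⟨X, Y⟩ = Tr X* Y`.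
Since `⟨I, X⟩ = Tr X`, the space `A ⊖ ℂI` consists of the elements of `A` of trace zero. -/
def Complementary {m : Type*} [Fintype m] [DecidableEq m]
    (A B : StarSubalgebra ℂ (Matrix m m ℂ)) : Prop :=
  ∀ a ∈ A, ∀ b ∈ B, a.trace = 0 → b.trace = 0 → (a.conjTranspose * b).trace = 0

/-- An F-subalgebra of `M_n ⊗ M_n`: a unital `*`-subalgebra that is `*`-isomorphic to `M_n`.
Here `M_n ⊗ M_n` is realised, through the Kronecker product, as the algebra of matrices indexed
by `Fin n × Fin n` (see `Matrix.kroneckerTMulAlgEquiv`). -/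
def IsFSubalgebra {n : ℕ}
    (A : StarSubalgebra ℂ (Matrix (Fin n × Fin n) (Fin n × Fin n) ℂ)) : Prop :=
  Nonempty (A ≃⋆ₐ[ℂ] Matrix (Fin n) (Fin n) ℂ)

/-- An M-subalgebra: a maximal Abelian unital `*`-subalgebra. -/
def IsMSubalgebra {m : Type*} [Fintype m] [DecidableEq m]
    (A : StarSubalgebra ℂ (Matrix m m ℂ)) : Prop :=
  Maximal (fun B : StarSubalgebra ℂ (Matrix m m ℂ) ↦ ∀ x ∈ B, ∀ y ∈ B, x * y = y * x) A

section CondExp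

open scoped ComplexOrder

variable {m : Type*} [Fintype m]

/-- The entries of a matrix as a vector of a Euclidean space; this identifies the Hilbert-Schmidt
inner product with the Euclidean one. -/
noncomputable def hsEquiv : Matrix m m ℂ ≃ₗ[ℂ] EuclideanSpace ℂ (m × m) :=
  (LinearEquiv.curry ℂ ℂ m m).symm ≪≫ₗ (WithLp.linearEquiv 2 ℂ (m × m → ℂ)).symm

theorem inner_hsEquiv (X Y : Matrix m m ℂ) :
    inner ℂ (hsEquiv X) (hsEquiv Y) = (X.conjTranspose * Y).trace := by
  simp only [PiLp.inner_apply, Fintype.sum_prod_type, Matrix.trace, Matrix.diag_apply,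
    Matrix.mul_apply, Matrix.conjTranspose_apply]
  rw [Finset.sum_comm]
  refine Finset.sum_congr rfl fun i _ ↦ Finset.sum_congr rfl fun j _ ↦ ?_
  exact mul_comm _ _

variable [DecidableEq m]

/-- The trace-preserving conditional expectation of the full matrix algebra onto the
`*`-subalgebra `A`: the orthogonal projection onto `A` for the Hilbert-Schmidt inner product. -/
noncomputable def condExp (A : StarSubalgebra ℂ (Matrix m m ℂ)) :
    Matrix m m ℂ →ₗ[ℂ] Matrix m m ℂ :=
  hsEquiv.symm.toLinearMap
    ∘ₗ ((Subalgebra.toSubmodule A.toSubalgebra).map hsEquiv.toLinearMap).starProjection.toLinearMap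
    ∘ₗ hsEquiv.toLinearMap

theorem condExp_mem (A : StarSubalgebra ℂ (Matrix m m ℂ)) (X : Matrix m m ℂ) :
    condExp A X ∈ A := by
  obtain ⟨a, ha, h⟩ := Submodule.mem_map.1 (Submodule.starProjection_apply_mem
    ((Subalgebra.toSubmodule A.toSubalgebra).map hsEquiv.toLinearMap) (hsEquiv X))
  have : condExp A X = a := hsEquiv.symm_apply_eq.2 h.symm
  rw [this]
  exact ha

theorem trace_mul_condExp (A : StarSubalgebra ℂ (Matrix m m ℂ)) (X : Matrix m m ℂ)
    {a : Matrix m m ℂ} (ha : a ∈ A) : (a * condExp A X).trace = (a * X).trace := by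
  have hs : a.conjTranspose ∈ A := star_mem ha
  have h := Submodule.starProjection_inner_eq_zero (K :=
    (Subalgebra.toSubmodule A.toSubalgebra).map hsEquiv.toLinearMap) (hsEquiv X)
    (hsEquiv a.conjTranspose) (Submodule.mem_map_of_mem hs)
  have e : Submodule.starProjection
      ((Subalgebra.toSubmodule A.toSubalgebra).map hsEquiv.toLinearMap) (hsEquiv X)
      = hsEquiv (condExp A X) := (hsEquiv.apply_symm_apply _).symm
  rw [e, ← map_sub, ← inner_conj_symm, map_eq_zero, inner_hsEquiv,
    Matrix.conjTranspose_conjTranspose, mul_sub, Matrix.trace_sub, sub_eq_zero] at h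
  exact h.symm

/-- `condExp A X` is the only element of `A` with the same trace pairings against `A` as `X`. -/
theorem condExp_eq_of_trace (A : StarSubalgebra ℂ (Matrix m m ℂ)) {X Y : Matrix m m ℂ}
    (hY : Y ∈ A) (h : ∀ a ∈ A, (a * Y).trace = (a * X).trace) : condExp A X = Y := by
  have hd : condExp A X - Y ∈ A := sub_mem (condExp_mem A X) hY
  have h0 : ((condExp A X - Y).conjTranspose * (condExp A X - Y)).trace = 0 := by
    have hs : (condExp A X - Y).conjTranspose ∈ A := star_mem hd
    rw [mul_sub, Matrix.trace_sub, trace_mul_condExp A X hs, h _ hs, sub_self]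
  exact sub_eq_zero.1 (Matrix.trace_conjTranspose_mul_self_eq_zero_iff.1 h0)

/-- The map is trace preserving. -/
theorem trace_condExp (A : StarSubalgebra ℂ (Matrix m m ℂ)) (X : Matrix m m ℂ) :
    (condExp A X).trace = X.trace := by
  simpa using trace_mul_condExp A X (one_mem A)

/-- The map fixes `A`. -/
theorem condExp_of_mem (A : StarSubalgebra ℂ (Matrix m m ℂ)) {X : Matrix m m ℂ} (hX : X ∈ A) :
    condExp A X = X :=
  condExp_eq_of_trace A hX fun _ _ ↦ rfl

/-- The bimodule property of a conditional expectation. -/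
theorem condExp_mul_mul (A : StarSubalgebra ℂ (Matrix m m ℂ)) {a b : Matrix m m ℂ} (ha : a ∈ A)
    (hb : b ∈ A) (X : Matrix m m ℂ) : condExp A (a * X * b) = a * condExp A X * b := by
  refine condExp_eq_of_trace A (mul_mem (mul_mem ha (condExp_mem A X)) hb) fun c hc ↦ ?_
  have key : ∀ Z : Matrix m m ℂ, (c * (a * Z * b)).trace = ((b * c * a) * Z).trace := fun Z ↦ by
    rw [← mul_assoc, Matrix.trace_mul_comm]
    simp only [mul_assoc]
  rw [key, key, trace_mul_condExp A X (mul_mem (mul_mem hb hc) ha)]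

/-- The generalized Pauli channel of a family of `*`-subalgebras `A i` of an `N × N` full matrix
algebra, `X ↦ (1 - ∑ i, c i) (Tr X / N) I + ∑ i, c i E_i(X)`, where `E_i` is the trace-preserving
conditional expectation onto `A i`. -/
noncomputable def pauliMap {ι : Type*} [Fintype ι] (A : ι → StarSubalgebra ℂ (Matrix m m ℂ))
    (c : ι → ℝ) : Matrix m m ℂ →ₗ[ℂ] Matrix m m ℂ :=
  ((1 - ∑ i, (c i : ℂ)) / (Fintype.card m : ℂ)) •
      (Matrix.traceLinearMap m ℂ ℂ).smulRight (1 : Matrix m m ℂ)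
    + ∑ i, (c i : ℂ) • condExp (A i)

/-- On matrices of trace zero, the generalized Pauli channel is `B ↦ ∑ i, c i E_i(B)`. -/
theorem pauliMap_of_trace_eq_zero {ι : Type*} [Fintype ι]
    (A : ι → StarSubalgebra ℂ (Matrix m m ℂ)) (c : ι → ℝ) {B : Matrix m m ℂ}
    (hB : B.trace = 0) : pauliMap A c B = ∑ i, (c i : ℂ) • condExp (A i) B := by
  simp [pauliMap, hB]

/-- The generalized Pauli channel is trace preserving. -/
theorem trace_pauliMap {ι : Type*} [Fintype ι] [Nonempty m]
    (A : ι → StarSubalgebra ℂ (Matrix m m ℂ)) (c : ι → ℝ) (X : Matrix m m ℂ) :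
    (pauliMap A c X).trace = X.trace := by
  have hm : (Fintype.card m : ℂ) ≠ 0 := Nat.cast_ne_zero.2 Fintype.card_ne_zero
  simp only [pauliMap, LinearMap.add_apply, LinearMap.smul_apply, LinearMap.smulRight_apply,
    Matrix.traceLinearMap_apply, LinearMap.sum_apply, Matrix.trace_add, Matrix.trace_smul,
    Matrix.trace_sum, trace_condExp, Matrix.trace_one, smul_eq_mul, ← Finset.sum_mul]
  field_simp
  ring

end CondExp

section CP

open scoped MatrixOrder Matrix.Norms.L2Operator

/-- Complete positivity of a linear map of a full matrix algebra, regarded as a C*-algebra with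
the operator norm and with the positive semidefinite matrices as positive elements. -/
def IsCompletelyPositive {m : Type*} [Fintype m] [DecidableEq m]
    (φ : Matrix m m ℂ →ₗ[ℂ] Matrix m m ℂ) : Prop :=
  ∃ Φ : CompletelyPositiveMap (Matrix m m ℂ) (Matrix m m ℂ), Φ.toLinearMap = φ

end CP

end PauliChannel

/-!
Let `N = n ^ 2`. By Choi's theorem (`isCompletelyPositive_iff_posSemidef_choi`) a map `φ` of `M_N`
is completely positive iff its Choi matrix, an operator on `M_N` with the Hilbert-Schmidt inner
product, is positive semidefinite. The map `X ↦ Tr X I` has the identity as its Choi matrix, and the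
conditional expectation onto a subalgebra `A` with Hilbert-Schmidt orthonormal basis `f k` has the
Choi matrix `P : Y ↦ ∑ k, f k * Y * (f k)ᴴ`. The point about F- and M-subalgebras is that, with
matrix units or minimal projections as the basis, `P` is seen to be an orthogonal projection that
fixes `I` and has trace `N` (`IsFSubalgebra.exists_isCommutantFrame`,
`IsMSubalgebra.exists_isCommutantFrame`); it is the projection onto the commutant of `A`.

If `A` and `B` are complementary, then `Tr (a b) = Tr a Tr b / N` for `a ∈ A` and `b ∈ B`, so the
projections `P` and `Q` of `A` and `B` satisfy `Tr (P Q) = 1`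
(`IsCommutantFrame.trace_mul_frameMatrix`). With `E₀` the projection onto `ℂ I`, this says that the
projections `P - E₀` and `Q - E₀` have a product of trace zero, so they are orthogonal. For `N + 1`
pairwise complementary subalgebras, the projections `E₀` and `P i - E₀` have traces
`1 + (N + 1) (N - 1) = N ^ 2` in total, hence add up to the identity (`sum_commutantProj`). With
`s = ∑ i, c i`, the Choi matrix of the generalized Pauli channel is therefore
`((1 - s) / N + s) E₀ + ∑ i, ((1 - s) / N + c i) (P i - E₀)` (`choi_pauliMap_eq_sum`), and it is
positive semidefinite iff all these coefficients are nonnegative, which are the stated inequalities.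
-/

namespace PauliChannel

open scoped ComplexOrder Matrix Kronecker

/-- `CStarAlgebra.nonneg_iff_eq_star_mul_self` in a form that elaborates for `CStarMatrix`, where
the instances of the continuous functional calculus are not found directly. -/
theorem exists_eq_star_mul_self_of_nonneg {R : Type*} [NonUnitalCStarAlgebra R] [PartialOrder R]
    [StarOrderedRing R] {a : R} (ha : 0 ≤ a) : ∃ b, a = star b * b :=
  CStarAlgebra.nonneg_iff_eq_star_mul_self.1 ha

/-! ### Choi's theorem -/

section Choi

variable {m : Type*} [DecidableEq m]

/-- The Choi matrix of a linear map `φ` of a full matrix algebra. The indices are arranged so that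
`X ↦ v * X * vᴴ` has the Choi matrix `w wᴴ`, where `w (a, b) = v a b`. -/
def choi (φ : Matrix m m ℂ →ₗ[ℂ] Matrix m m ℂ) : Matrix (m × m) (m × m) ℂ :=
  Matrix.of fun p q ↦ φ (Matrix.single p.2 q.2 1) p.1 q.1

theorem choi_apply (φ : Matrix m m ℂ →ₗ[ℂ] Matrix m m ℂ) (a b c d : m) :
    choi φ (a, b) (c, d) = φ (Matrix.single b d 1) a c := rfl

variable [Fintype m]

theorem apply_eq_sum_choi (φ : Matrix m m ℂ →ₗ[ℂ] Matrix m m ℂ) (X : Matrix m m ℂ) (a c : m) :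
    φ X a c = ∑ b, ∑ d, X b d * choi φ (a, b) (c, d) := by
  conv_lhs => rw [Matrix.matrix_eq_sum_single X]
  simp only [map_sum, Matrix.sum_apply, choi_apply]
  refine Finset.sum_congr rfl fun b _ ↦ Finset.sum_congr rfl fun d _ ↦ ?_
  have : Matrix.single b d (X b d) = X b d • Matrix.single b d (1 : ℂ) := by
    simp [Matrix.smul_single]
  rw [this, map_smul, Matrix.smul_apply, smul_eq_mul]

/-- A positive semidefinite Choi matrix yields a Kraus decomposition. -/
theorem exists_kraus_of_posSemidef_choi {φ : Matrix m m ℂ →ₗ[ℂ] Matrix m m ℂ}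
    (h : (choi φ).PosSemidef) :
    ∃ w : m × m → Matrix m m ℂ, ∀ X, φ X = ∑ k, w k * X * (w k).conjTranspose := by
  obtain ⟨B, hB⟩ : ∃ B : Matrix (m × m) (m × m) ℂ, choi φ = B.conjTranspose * B := by
    open scoped MatrixOrder Matrix.Norms.L2Operator in
    exact CStarAlgebra.nonneg_iff_eq_star_mul_self.1 h.nonneg
  refine ⟨fun k ↦ Matrix.of fun a b ↦ star (B k (a, b)), fun X ↦ ?_⟩
  ext a c
  rw [apply_eq_sum_choi, hB]
  simp only [Matrix.sum_apply, Matrix.mul_apply, Matrix.conjTranspose_apply, Matrix.of_apply,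
    star_star, Finset.mul_sum, Finset.sum_mul]
  have swap : ∀ F : m → m → m × m → ℂ,
      ∑ b, ∑ d, ∑ k, F b d k = ∑ k, ∑ d, ∑ b, F b d k := fun F ↦ by
    rw [Finset.sum_comm]
    simp_rw [Finset.sum_comm (s := (Finset.univ : Finset m)) (t := (Finset.univ : Finset (m × m)))]
  rw [swap]
  refine Finset.sum_congr rfl fun k _ ↦ Finset.sum_congr rfl fun d _ ↦
    Finset.sum_congr rfl fun b _ ↦ ?_
  ring

section Order

open scoped MatrixOrder Matrix.Norms.L2Operator

theorem posSemidef_choi_of_isCompletelyPositive {φ : Matrix m m ℂ →ₗ[ℂ] Matrix m m ℂ}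
    (h : IsCompletelyPositive φ) : (choi φ).PosSemidef := by
  obtain ⟨Φ, rfl⟩ := h
  rcases isEmpty_or_nonempty m with hm | ⟨⟨e⟩⟩
  · have : choi Φ.toLinearMap = 0 := Subsingleton.elim _ _
    rw [this]
    exact Matrix.PosSemidef.zero
  -- The block matrix `(E_bd)` is positive: it is `star V * V`, where `V` has the single nonzero
  -- block row `(E_ed)`.
  let V : CStarMatrix m m (Matrix m m ℂ) := CStarMatrix.ofMatrix
    (Matrix.of fun c d ↦ if c = e then Matrix.single e d 1 else 0)
  have hV : ∀ b d, (star V * V) b d = Matrix.single b d (1 : ℂ) := fun b d ↦ by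
    have : ∀ c, star (V c b) * V c d = if c = e then Matrix.single b d (1 : ℂ) else 0 := fun c ↦ by
      by_cases hc : c = e <;> simp [V, hc, Matrix.star_eq_conjTranspose]
    rw [CStarMatrix.mul_apply]
    simp only [CStarMatrix.star_apply, this]
    simp
  obtain ⟨S, hS⟩ := exists_eq_star_mul_self_of_nonneg
    (Φ.map_cstarMatrix_nonneg (star V * V) (star_mul_self_nonneg V))
  have hΦ : ∀ b d, Φ.toLinearMap (Matrix.single b d 1) = ∑ k, star (S k b) * S k d := fun b d ↦ by
    have := congrFun (congrFun hS b) d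
    rw [CStarMatrix.map_apply, hV, CStarMatrix.mul_apply] at this
    exact this
  let B : Matrix (m × m) (m × m) ℂ := Matrix.of fun k p ↦ S k.1 p.2 k.2 p.1
  have : choi Φ.toLinearMap = B.conjTranspose * B := by
    ext ⟨a, b⟩ ⟨c, d⟩
    rw [choi_apply, hΦ, Matrix.mul_apply, Fintype.sum_prod_type, Matrix.sum_apply]
    rfl
  rw [this]
  exact Matrix.posSemidef_conjTranspose_mul_self _

theorem isCompletelyPositive_of_kraus {φ : Matrix m m ℂ →ₗ[ℂ] Matrix m m ℂ} {κ : Type*} [Fintype κ]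
    (w : κ → Matrix m m ℂ) (h : ∀ X, φ X = ∑ k, w k * X * (w k).conjTranspose) :
    IsCompletelyPositive φ := by
  refine ⟨{ toLinearMap := φ, map_cstarMatrix_nonneg' := fun k M hM ↦ ?_ }, rfl⟩
  obtain ⟨S, rfl⟩ := exists_eq_star_mul_self_of_nonneg hM
  let T : κ → CStarMatrix (Fin k) (Fin k) (Matrix m m ℂ) := fun l ↦ CStarMatrix.ofMatrix
    (Matrix.of fun i j ↦ S i j * (w l).conjTranspose)
  have : (star S * S).map φ = ∑ l, star (T l) * T l := by
    refine CStarMatrix.ext fun i j ↦ ?_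
    have hs : (∑ l, star (T l) * T l) i j = ∑ l, (star (T l) * T l) i j :=
      Matrix.sum_apply i j Finset.univ fun l ↦ CStarMatrix.ofMatrix.symm (star (T l) * T l)
    rw [hs, CStarMatrix.map_apply, h]
    refine Finset.sum_congr rfl fun l _ ↦ ?_
    rw [CStarMatrix.mul_apply, CStarMatrix.mul_apply, Finset.mul_sum, Finset.sum_mul]
    refine Finset.sum_congr rfl fun x _ ↦ ?_
    have h1 : T l x j = S x j * (w l).conjTranspose := rfl
    have h2 : (star (T l)) i x = w l * star (S x i) := by
      rw [CStarMatrix.star_apply]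
      change (S x i * (w l).conjTranspose).conjTranspose = _
      simp [Matrix.star_eq_conjTranspose]
    rw [h1, h2, CStarMatrix.star_apply]
    simp only [mul_assoc]
  change 0 ≤ (star S * S).map φ
  rw [this]
  exact Finset.sum_nonneg fun l _ ↦ star_mul_self_nonneg _

end Order

/-- Choi's theorem. -/
theorem isCompletelyPositive_iff_posSemidef_choi {φ : Matrix m m ℂ →ₗ[ℂ] Matrix m m ℂ} :
    IsCompletelyPositive φ ↔ (choi φ).PosSemidef := by
  refine ⟨posSemidef_choi_of_isCompletelyPositive, fun h ↦ ?_⟩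
  obtain ⟨w, hw⟩ := exists_kraus_of_posSemidef_choi h
  exact isCompletelyPositive_of_kraus w hw

end Choi

/-! ### Frames of subalgebras and the projections onto their commutants -/

section Frame

theorem conjTranspose_map_star {m : Type*} (X : Matrix m m ℂ) : (X.map star)ᴴ = Xᴴ.map star := by
  ext; simp

theorem trace_map_star {m : Type*} [Fintype m] (X : Matrix m m ℂ) :
    (X.map star).trace = star X.trace := by
  simp [Matrix.trace]

theorem map_star_mul {m : Type*} [Fintype m] (X Y : Matrix m m ℂ) :
    (X * Y).map star = X.map star * Y.map star := by
  ext; simp [Matrix.mul_apply]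

variable {m : Type*} [Fintype m] [DecidableEq m]

/-- The Choi matrix of `X ↦ ∑ k, Tr ((f k)ᴴ * X) f k`, which is the orthogonal projection onto the
span of `f` if `f` is orthonormal for the Hilbert-Schmidt inner product. Its action on vectors
indexed by `m × m`, read as matrices, is `Y ↦ ∑ k, f k * Y * (f k)ᴴ`. -/
noncomputable def frameMatrix {κ : Type*} [Fintype κ] (f : κ → Matrix m m ℂ) :
    Matrix (m × m) (m × m) ℂ :=
  ∑ k, f k ⊗ₖ (f k).map star

/-- A frame of a `*`-subalgebra `A` of `M_N` is a family in `A` that reproduces the elements of `A`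
as a Hilbert-Schmidt orthonormal basis does, for which `Y ↦ ∑ k, f k * Y * (f k)ᴴ` is an orthogonal
projection that fixes `I`, of trace `N`. This projection is the conditional expectation onto the
commutant of `A`. -/
structure IsCommutantFrame {κ : Type*} [Fintype κ] (A : StarSubalgebra ℂ (Matrix m m ℂ))
    (f : κ → Matrix m m ℂ) : Prop where
  mem : ∀ k, f k ∈ A
  sum_trace_smul : ∀ a ∈ A, ∑ k, ((f k)ᴴ * a).trace • f k = a
  sum_mul_conjTranspose : ∑ k, f k * (f k)ᴴ = 1
  sum_trace : ∑ k, (f k).trace * star (f k).trace = Fintype.card m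
  isHermitian : (frameMatrix f).IsHermitian
  mul_self : frameMatrix f * frameMatrix f = frameMatrix f

variable {κ : Type*} [Fintype κ] {A : StarSubalgebra ℂ (Matrix m m ℂ)} {f : κ → Matrix m m ℂ}

theorem IsCommutantFrame.condExp_apply (hf : IsCommutantFrame A f) (X : Matrix m m ℂ) :
    condExp A X = ∑ k, ((f k)ᴴ * X).trace • f k := by
  refine condExp_eq_of_trace A (sum_mem fun k _ ↦ A.smul_mem (hf.mem k) _) fun a ha ↦ ?_
  have h : a = ∑ k, (a * f k).trace • (f k)ᴴ := by
    have := congrArg Matrix.conjTranspose (hf.sum_trace_smul aᴴ (star_mem ha))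
    rw [Matrix.conjTranspose_conjTranspose, Matrix.conjTranspose_sum] at this
    rw [← this]
    refine Finset.sum_congr rfl fun k _ ↦ ?_
    rw [Matrix.conjTranspose_smul, this, ← Matrix.trace_conjTranspose, Matrix.conjTranspose_mul,
      Matrix.conjTranspose_conjTranspose, Matrix.conjTranspose_conjTranspose]
  conv_rhs => rw [h]
  simp only [Finset.mul_sum, Finset.sum_mul, Matrix.trace_sum, Matrix.mul_smul, Matrix.smul_mul,
    Matrix.trace_smul, smul_eq_mul]
  exact Finset.sum_congr rfl fun k _ ↦ mul_comm _ _

theorem IsCommutantFrame.choi_condExp (hf : IsCommutantFrame A f) :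
    choi (condExp A) = frameMatrix f := by
  ext ⟨a, b⟩ ⟨c, d⟩
  rw [choi_apply, hf.condExp_apply, frameMatrix, Matrix.sum_apply, Matrix.sum_apply]
  refine Finset.sum_congr rfl fun k _ ↦ ?_
  simp [Matrix.trace_mul_single, mul_comm]

end Frame

/-! ### F-subalgebras -/

section FSubalgebra

variable {n : ℕ}

/-- An F-subalgebra has a frame: the image of the matrix units of `M_n`, scaled by `1 / √n`. -/
theorem IsFSubalgebra.exists_isCommutantFrame (hn : n ≠ 0)
    {A : StarSubalgebra ℂ (Matrix (Fin n × Fin n) (Fin n × Fin n) ℂ)} (hA : IsFSubalgebra A) :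
    ∃ f : Fin n × Fin n → Matrix (Fin n × Fin n) (Fin n × Fin n) ℂ, IsCommutantFrame A f := by
  obtain ⟨φ⟩ := hA
  have hn0 : (n : ℂ) ≠ 0 := Nat.cast_ne_zero.2 hn
  let u : Fin n → Fin n → Matrix (Fin n × Fin n) (Fin n × Fin n) ℂ :=
    fun i j ↦ (φ.symm (Matrix.single i j 1) : A)
  have u_mem : ∀ i j, u i j ∈ A := fun i j ↦ (φ.symm (Matrix.single i j 1)).2
  -- The images `u i j` of the matrix units are again matrix units; their traces are those of
  -- `E_ij` multiplied by `n`, the multiplicity of the representation.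
  have u_mul : ∀ i j k l, u i j * u k l = if j = k then u i l else 0 := fun i j k l ↦ by
    simp only [u, ← MulMemClass.coe_mul, ← map_mul]
    split_ifs with h
    · subst h; simp
    · simp [h]
  have u_star : ∀ i j, (u i j)ᴴ = u j i := fun i j ↦ by
    simp only [u, ← Matrix.star_eq_conjTranspose, ← StarMemClass.coe_star, ← map_star]
    simp [Matrix.star_eq_conjTranspose]
  have u_one : ∑ i, u i i = 1 := by
    have h : ∑ i, Matrix.single i i (1 : ℂ) = (1 : Matrix (Fin n) (Fin n) ℂ) := by
      ext a b
      simp [Matrix.sum_apply, Matrix.single_apply, Matrix.one_apply, ite_and]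
    have := congrArg (fun X ↦ ((φ.symm X : A) : Matrix (Fin n × Fin n) (Fin n × Fin n) ℂ)) h
    simpa [u] using this
  have u_span : ∀ a ∈ A, ∃ x : Fin n → Fin n → ℂ, a = ∑ i, ∑ j, x i j • u i j := fun a ha ↦ by
    refine ⟨fun i j ↦ φ ⟨a, ha⟩ i j, ?_⟩
    have h : (⟨a, ha⟩ : A) = φ.symm (∑ i, ∑ j, φ ⟨a, ha⟩ i j • Matrix.single i j 1) := by
      rw [eq_comm, StarAlgEquiv.symm_apply_eq]
      conv_rhs => rw [Matrix.matrix_eq_sum_single (φ ⟨a, ha⟩)]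
      simp [Matrix.smul_single]
    have := congrArg Subtype.val h
    simpa [u, map_sum, -Matrix.smul_single] using this
  have tr_ne : ∀ i j, i ≠ j → (u i j).trace = 0 := fun i j hij ↦ by
    have h := u_mul i i i j
    rw [if_pos rfl] at h
    rw [← h, Matrix.trace_mul_comm, u_mul, if_neg (Ne.symm hij), Matrix.trace_zero]
  have tr_eq : ∀ i, (u i i).trace = n := fun i ↦ by
    have h : ∀ j, (u j j).trace = (u i i).trace := fun j ↦ by
      have h1 := u_mul i j j i
      have h2 := u_mul j i i j
      rw [if_pos rfl] at h1 h2
      rw [← h1, ← h2, Matrix.trace_mul_comm]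
    have h1 := congrArg Matrix.trace u_one
    rw [Matrix.trace_sum, Finset.sum_congr rfl fun j _ ↦ h j] at h1
    simp only [Finset.sum_const, Finset.card_univ, Fintype.card_fin, nsmul_eq_mul,
      Matrix.trace_one, Fintype.card_prod, Nat.cast_mul] at h1
    exact mul_left_cancel₀ hn0 h1
  have tr_u : ∀ i j, (u i j).trace = if i = j then (n : ℂ) else 0 := fun i j ↦ by
    split_ifs with h
    · rw [h, tr_eq]
    · exact tr_ne i j h
  -- Each `u i j` has squared Hilbert-Schmidt norm `Tr (u j j) = n`.
  let r : ℂ := (((Real.sqrt n)⁻¹ : ℝ) : ℂ)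
  have r_star : star r = r := Complex.conj_ofReal _
  have r_mul : r * r = (n : ℂ)⁻¹ := by
    rw [← Complex.ofReal_mul, ← mul_inv, Real.mul_self_sqrt (Nat.cast_nonneg n)]
    simp
  have hP : frameMatrix (fun p : Fin n × Fin n ↦ r • u p.1 p.2)
      = (n : ℂ)⁻¹ • ∑ i, ∑ j, u i j ⊗ₖ (u i j).map star := by
    rw [frameMatrix, Fintype.sum_prod_type]
    simp only [Finset.smul_sum]
    refine Finset.sum_congr rfl fun i _ ↦ Finset.sum_congr rfl fun j _ ↦ ?_
    ext p q
    simp only [Matrix.kroneckerMap_apply, Matrix.smul_apply, Matrix.map_apply, smul_eq_mul,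
      star_mul', r_star, ← r_mul]
    ring
  refine ⟨fun p ↦ r • u p.1 p.2, fun k ↦ A.smul_mem (u_mem _ _) _, fun a ha ↦ ?_, ?_, ?_, ?_, ?_⟩
  · obtain ⟨x, hx⟩ := u_span a ha
    have h : ∀ i j, (u j i * a).trace = n * x i j := fun i j ↦ by
      rw [hx]
      simp only [Finset.mul_sum, Matrix.mul_smul, u_mul, Matrix.trace_sum, Matrix.trace_smul]
      rw [Finset.sum_eq_single i, Finset.sum_eq_single j]
      · simp [tr_eq, mul_comm]
      · intro l _ hl
        simp [tr_ne j l (Ne.symm hl)]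
      · simp
      · intro k _ hk
        simp [Ne.symm hk]
      · simp
    rw [Fintype.sum_prod_type]
    conv_rhs => rw [hx]
    refine Finset.sum_congr rfl fun i _ ↦ Finset.sum_congr rfl fun j _ ↦ ?_
    rw [Matrix.conjTranspose_smul, u_star, Matrix.smul_mul, Matrix.trace_smul, h, smul_smul,
      r_star, smul_eq_mul]
    congr 1
    calc r * (n * x i j) * r = (r * r) * n * x i j := by ring
      _ = x i j := by rw [r_mul, inv_mul_cancel₀ hn0, one_mul]
  · rw [Fintype.sum_prod_type]
    simp only [Matrix.conjTranspose_smul, u_star, Matrix.smul_mul, Matrix.mul_smul, smul_smul,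
      r_star, r_mul, u_mul, if_true]
    simp only [← Finset.smul_sum, Finset.sum_const, Finset.card_univ, Fintype.card_fin,
      ← Nat.cast_smul_eq_nsmul ℂ]
    rw [smul_smul, inv_mul_cancel₀ hn0, one_smul, u_one]
  · rw [Fintype.sum_prod_type]
    simp only [Matrix.trace_smul, tr_u, smul_eq_mul, star_mul', r_star]
    have : ∀ i j : Fin n, (r * if i = j then (n : ℂ) else 0)
        * (r * star (if i = j then (n : ℂ) else 0)) = if i = j then (n : ℂ) else 0 := fun i j ↦ by
      split_ifs
      · rw [star_natCast]
        calc r * n * (r * n) = (r * r) * n * n := by ring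
          _ = n := by rw [r_mul, inv_mul_cancel₀ hn0, one_mul]
      · simp
    simp only [this]
    simp
  · rw [hP, Matrix.IsHermitian, Matrix.conjTranspose_smul]
    simp only [Matrix.conjTranspose_sum, Matrix.conjTranspose_kronecker, conjTranspose_map_star,
      u_star, star_inv₀, star_natCast]
    rw [Finset.sum_comm]
  · have hk : ∀ i j k l, (u i j ⊗ₖ (u i j).map star) * (u k l ⊗ₖ (u k l).map star)
        = if j = k then u i l ⊗ₖ (u i l).map star else 0 := fun i j k l ↦ by
      rw [← Matrix.mul_kronecker_mul, ← map_star_mul, u_mul]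
      split_ifs <;> simp
    rw [hP, Matrix.smul_mul, Matrix.mul_smul]
    congr 1
    simp only [Finset.sum_mul]
    simp only [Finset.mul_sum, hk, Finset.sum_ite_irrel, Finset.sum_const_zero, Finset.sum_ite_eq,
      Finset.mem_univ, if_true, Finset.sum_const, Finset.card_univ, Fintype.card_fin,
      ← Nat.cast_smul_eq_nsmul ℂ, ← Finset.smul_sum]
    rw [smul_smul, inv_mul_cancel₀ hn0, one_smul]

end FSubalgebra

/-! ### M-subalgebras -/

section MSubalgebra

/-- A commuting family of symmetric operators, indexed by a possibly infinite type, has an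
orthonormal basis of joint eigenvectors. -/
theorem exists_orthonormalBasis_joint_eigenvectors {m E ι : Type*} [Fintype m]
    [NormedAddCommGroup E] [InnerProductSpace ℂ E] [FiniteDimensional ℂ E] {T : ι → E →ₗ[ℂ] E}
    (hT : ∀ i, (T i).IsSymmetric) (hC : ∀ i j, Commute (T i) (T j))
    (hm : Module.finrank ℂ E = Fintype.card m) :
    ∃ v : OrthonormalBasis m ℂ E, ∀ i k, ∃ z : ℂ, T i (v k) = z • v k := by
  classical
  have htop := LinearMap.IsSymmetric.iSup_iInf_eq_top_of_commute hT fun i j _ ↦ hC i j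
  have horth := LinearMap.IsSymmetric.orthogonalFamily_iInf_eigenspaces hT
  let W : (ι → ℂ) → Submodule ℂ E := fun χ ↦ ⨅ i, Module.End.eigenspace (T i) (χ i)
  -- Orthonormal bases of the joint eigenspaces, most of which are zero, are put together.
  let κ := Σ χ : ι → ℂ, Fin (Module.finrank ℂ (W χ))
  let w : κ → E := fun p ↦ (stdOrthonormalBasis ℂ (W p.1) p.2 : W p.1)
  have hw : Orthonormal ℂ w :=
    horth.orthonormal_sigma_orthonormal fun χ ↦ (stdOrthonormalBasis ℂ (W χ)).orthonormal
  have hfin : Finite κ := hw.linearIndependent.finite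
  have := Fintype.ofFinite κ
  have hspan : ⊤ ≤ Submodule.span ℂ (Set.range w) := by
    rw [← htop]
    refine iSup_le fun χ x hx ↦ ?_
    have hx' := congrArg Subtype.val ((stdOrthonormalBasis ℂ (W χ)).sum_repr ⟨x, hx⟩)
    change _ = x at hx'
    rw [← hx', Submodule.coe_sum]
    exact sum_mem fun k _ ↦ Submodule.smul_mem _ _ (Submodule.subset_span ⟨⟨χ, k⟩, rfl⟩)
  have hcard : Fintype.card κ = Fintype.card m := by
    rw [← hm, Module.finrank_eq_card_basis (OrthonormalBasis.mk hw hspan).toBasis]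
  let e := Fintype.equivOfCardEq hcard
  refine ⟨(OrthonormalBasis.mk hw hspan).reindex e, fun i k ↦ ⟨(e.symm k).1 i, ?_⟩⟩
  rw [OrthonormalBasis.reindex_apply, OrthonormalBasis.coe_mk]
  have h2 : w (e.symm k) ∈ W (e.symm k).1 := Subtype.prop _
  exact Module.End.mem_eigenspace_iff.1 ((Submodule.mem_iInf _).1 h2 i)

variable {m : Type*} [Fintype m] [DecidableEq m]

/-- The elements of an Abelian `*`-subalgebra are simultaneously diagonalized by a unitary. -/
theorem exists_unitary_diagonalizing {A : StarSubalgebra ℂ (Matrix m m ℂ)}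
    (hA : ∀ x ∈ A, ∀ y ∈ A, x * y = y * x) :
    ∃ V : Matrix m m ℂ, Vᴴ * V = 1 ∧ ∀ a ∈ A, ∃ d : m → ℂ, a * V = V * Matrix.diagonal d := by
  let T : {a : Matrix m m ℂ // a ∈ A ∧ a.IsHermitian} →
    EuclideanSpace ℂ m →ₗ[ℂ] EuclideanSpace ℂ m := fun a ↦ Matrix.toEuclideanLin a.1
  obtain ⟨v, hv⟩ := exists_orthonormalBasis_joint_eigenvectors (m := m) (T := T)
    (fun i ↦ Matrix.isSymmetric_toEuclideanLin_iff.2 i.2.2) (fun i j ↦ by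
      have h := hA i.1 i.2.1 j.1 j.2.1
      refine LinearMap.ext fun x ↦ ?_
      simp only [T, Module.End.mul_apply, Matrix.toLpLin_apply, Matrix.mulVec_mulVec, h])
    finrank_euclideanSpace
  have hv0 : ∀ a ∈ A, a.IsHermitian → ∀ k : m, ∃ z : ℂ, a *ᵥ (v k).ofLp = z • (v k).ofLp :=
    fun a ha hh k ↦ by
      obtain ⟨z, hz⟩ := hv ⟨a, ha, hh⟩ k
      exact ⟨z, congrArg WithLp.ofLp hz⟩
  have hv' : ∀ a ∈ A, ∀ k : m, ∃ z : ℂ, a *ᵥ (v k).ofLp = z • (v k).ofLp := fun a ha k ↦ by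
    have hs : aᴴ ∈ A := star_mem ha
    obtain ⟨z, hz⟩ := hv0 (a + aᴴ) (add_mem ha hs) (by simp [Matrix.IsHermitian, add_comm]) k
    obtain ⟨y, hy⟩ := hv0 (Complex.I • (a - aᴴ)) (A.smul_mem (sub_mem ha hs) _)
      (by simp [Matrix.IsHermitian, ← smul_neg]) k
    -- `a` is a combination of the Hermitian elements `a + aᴴ` and `I • (a - aᴴ)` of `A`.
    refine ⟨2⁻¹ * (z - Complex.I * y), ?_⟩
    have ha2 : a = (2⁻¹ : ℂ) • ((a + aᴴ) - Complex.I • (Complex.I • (a - aᴴ))) := by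
      rw [smul_smul, Complex.I_mul_I, neg_smul, one_smul, sub_neg_eq_add, add_add_sub_cancel,
        ← two_smul ℂ a, smul_smul]
      norm_num
    have h3 : a *ᵥ (v k).ofLp = (2⁻¹ : ℂ) • ((a + aᴴ) *ᵥ (v k).ofLp
        - Complex.I • ((Complex.I • (a - aᴴ)) *ᵥ (v k).ofLp)) := by
      conv_lhs => rw [ha2]
      rw [Matrix.smul_mulVec, Matrix.sub_mulVec, Matrix.smul_mulVec Complex.I]
    rw [h3, hz, hy, smul_smul, ← sub_smul, smul_smul]
  refine ⟨Matrix.of fun i k ↦ v k i, ?_, fun a ha ↦ ?_⟩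
  · ext k l
    have h := orthonormal_iff_ite.1 v.orthonormal k l
    rw [Matrix.mul_apply, Matrix.one_apply, ← h, PiLp.inner_apply]
    exact Finset.sum_congr rfl fun i _ ↦ mul_comm _ _
  · choose z hz using hv' a ha
    refine ⟨z, ?_⟩
    ext i k
    rw [Matrix.mul_diagonal, mul_comm]
    exact congrFun (hz k) i

/-- A maximal Abelian subalgebra has a frame: its minimal projections. -/
theorem IsMSubalgebra.exists_isCommutantFrame {A : StarSubalgebra ℂ (Matrix m m ℂ)}
    (hA : IsMSubalgebra A) : ∃ f : m → Matrix m m ℂ, IsCommutantFrame A f := by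
  obtain ⟨V, hV, hdiag⟩ := exists_unitary_diagonalizing hA.1
  have hV' : V * Vᴴ = 1 := mul_eq_one_comm.1 hV
  let p : m → Matrix m m ℂ := fun k ↦ V * Matrix.single k k 1 * Vᴴ
  have p_mul : ∀ k l, p k * p l = if k = l then p k else 0 := fun k l ↦ by
    have : p k * p l = V * (Matrix.single k k 1 * Matrix.single l l 1) * Vᴴ := by
      calc p k * p l = V * Matrix.single k k 1 * (Vᴴ * V) * Matrix.single l l 1 * Vᴴ := by
            simp only [p, mul_assoc]
        _ = _ := by rw [hV, mul_one]; simp only [mul_assoc]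
    rw [this]
    split_ifs with h
    · subst h; simp [p]
    · simp [h]
  have p_star : ∀ k, (p k)ᴴ = p k := fun k ↦ by
    simp [p, mul_assoc]
  have p_one : ∑ k, p k = 1 := by
    have h : ∑ i, Matrix.single i i (1 : ℂ) = (1 : Matrix m m ℂ) := by
      ext a b
      simp [Matrix.sum_apply, Matrix.single_apply, Matrix.one_apply, ite_and]
    simp only [p, ← Finset.sum_mul, ← Finset.mul_sum, h, mul_one, hV']
  have tr_p : ∀ k, (p k).trace = 1 := fun k ↦ by
    rw [Matrix.trace_mul_comm, ← mul_assoc, hV, one_mul, Matrix.trace_single_eq_same]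
  have p_compress : ∀ k X, ∃ z : ℂ, p k * X * p k = z • p k := fun k X ↦ by
    refine ⟨(Vᴴ * X * V) k k, ?_⟩
    calc p k * X * p k = V * (Matrix.single k k 1 * (Vᴴ * X * V) * Matrix.single k k 1) * Vᴴ := by
          simp only [p, mul_assoc]
      _ = (Vᴴ * X * V) k k • p k := by
          rw [Matrix.single_mul_mul_single]
          have : Matrix.single k k ((Vᴴ * X * V) k k)
              = (Vᴴ * X * V) k k • Matrix.single k k (1 : ℂ) := by simp
          rw [one_mul, mul_one, this, Matrix.mul_smul, Matrix.smul_mul]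
  have mul_p : ∀ a ∈ A, ∀ k, ∃ z : ℂ, a * p k = z • p k := fun a ha k ↦ by
    obtain ⟨d, hd⟩ := hdiag a ha
    refine ⟨d k, ?_⟩
    simp only [p, ← mul_assoc, hd]
    rw [mul_assoc V, ← Matrix.smul_mul, ← Matrix.mul_smul]
    congr 2
    ext i j
    by_cases hi : k = i
    · subst hi; simp [Matrix.diagonal_mul, Matrix.single_apply]
    · simp [Matrix.diagonal_mul, hi]
  -- `A` lies in the commutant of the `p k`, which is Abelian, hence equal to `A`.
  let C : StarSubalgebra ℂ (Matrix m m ℂ) := StarSubalgebra.centralizer ℂ (Set.range p)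
  have mem_C : ∀ X, X ∈ C ↔ ∀ k, p k * X = X * p k := fun X ↦ by
    simp [C, StarSubalgebra.mem_centralizer_iff, Matrix.star_eq_conjTranspose, p_star]
  have C_mul : ∀ X ∈ C, ∀ k, ∃ z : ℂ, X * p k = z • p k := fun X hX k ↦ by
    obtain ⟨z, hz⟩ := p_compress k X
    refine ⟨z, ?_⟩
    rw [← hz, (mem_C X).1 hX, mul_assoc, p_mul, if_pos rfl]
  have C_comm : ∀ X ∈ C, ∀ Y ∈ C, X * Y = Y * X := fun X hX Y hY ↦ by
    rw [← mul_one (X * Y), ← mul_one (Y * X), ← p_one, Finset.mul_sum, Finset.mul_sum]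
    refine Finset.sum_congr rfl fun k _ ↦ ?_
    obtain ⟨x, hx⟩ := C_mul X hX k
    obtain ⟨y, hy⟩ := C_mul Y hY k
    rw [mul_assoc, mul_assoc, hx, hy, Matrix.mul_smul, Matrix.mul_smul, hx, hy, smul_comm]
  have A_le : A ≤ C := fun a ha ↦ (mem_C a).2 fun k ↦ by
    have hs : aᴴ ∈ A := star_mem ha
    obtain ⟨z, hz⟩ := mul_p a ha k
    obtain ⟨y, hy⟩ := mul_p aᴴ hs k
    have hy' : p k * a = star y • p k := by
      have := congrArg Matrix.conjTranspose hy
      simpa [p_star] using this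
    have h1 : p k * a * p k = star y • p k := by
      rw [hy', Matrix.smul_mul, p_mul, if_pos rfl]
    have h2 : p k * a * p k = z • p k := by
      rw [mul_assoc, hz, Matrix.mul_smul, p_mul, if_pos rfl]
    rw [hy', hz, ← h1, h2]
  have C_le : C ≤ A := hA.2 C_comm A_le
  refine ⟨p, fun k ↦ C_le ((mem_C _).2 fun l ↦ ?_), fun a ha ↦ ?_, ?_, ?_, ?_, ?_⟩
  · rw [p_mul, p_mul]
    by_cases h : l = k
    · subst h; rfl
    · rw [if_neg h, if_neg (Ne.symm h)]
  · conv_rhs => rw [← mul_one a, ← p_one, Finset.mul_sum]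
    refine Finset.sum_congr rfl fun k _ ↦ ?_
    obtain ⟨z, hz⟩ := mul_p a ha k
    rw [p_star, Matrix.trace_mul_comm, hz, Matrix.trace_smul, tr_p, smul_eq_mul, mul_one]
  · simp only [p_star, p_mul, if_true, p_one]
  · simp [tr_p]
  · simp only [frameMatrix, Matrix.IsHermitian, Matrix.conjTranspose_sum,
      Matrix.conjTranspose_kronecker, conjTranspose_map_star, p_star]
  · have hk : ∀ k l, (p k ⊗ₖ (p k).map star) * (p l ⊗ₖ (p l).map star)
        = if k = l then p k ⊗ₖ (p k).map star else 0 := fun k l ↦ by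
      rw [← Matrix.mul_kronecker_mul, ← map_star_mul, p_mul]
      split_ifs <;> simp
    simp only [frameMatrix, Finset.sum_mul, Finset.mul_sum, hk]
    simp

end MSubalgebra

/-! ### Relations between the projections -/

section Projections

variable {m : Type*}

/-- The identity matrix as a vector indexed by `m × m`. -/
def idVec (m : Type*) [DecidableEq m] : m × m → ℂ := fun p ↦ if p.1 = p.2 then 1 else 0

/-- The orthogonal projection onto the multiples of the identity matrix. -/
noncomputable def idProj (m : Type*) [Fintype m] [DecidableEq m] : Matrix (m × m) (m × m) ℂ :=
  (Fintype.card m : ℂ)⁻¹ • Matrix.vecMulVec (idVec m) (idVec m)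

theorem star_idVec [DecidableEq m] : star (idVec m) = idVec m := by
  ext p
  simp only [idVec, Pi.star_apply]
  split_ifs <;> simp

variable [Fintype m] [DecidableEq m]

theorem idVec_dotProduct_self : idVec m ⬝ᵥ idVec m = Fintype.card m := by
  simp [dotProduct, idVec, Fintype.sum_prod_type]

theorem isHermitian_idProj : (idProj m).IsHermitian := by
  rw [idProj, Matrix.IsHermitian, Matrix.conjTranspose_smul, Matrix.conjTranspose_vecMulVec,
    star_idVec, star_inv₀, star_natCast]

theorem trace_idProj [Nonempty m] : (idProj m).trace = 1 := by
  have hm : (Fintype.card m : ℂ) ≠ 0 := Nat.cast_ne_zero.2 Fintype.card_ne_zero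
  rw [idProj, Matrix.trace_smul, Matrix.trace_vecMulVec, idVec_dotProduct_self, smul_eq_mul,
    inv_mul_cancel₀ hm]

theorem idProj_mul_self [Nonempty m] : idProj m * idProj m = idProj m := by
  have hm : (Fintype.card m : ℂ) ≠ 0 := Nat.cast_ne_zero.2 Fintype.card_ne_zero
  rw [idProj, Matrix.smul_mul, Matrix.mul_smul, Matrix.vecMulVec_mul_vecMulVec,
    idVec_dotProduct_self, Matrix.vecMulVec_smul, inv_smul_smul₀ hm]

variable {κ κ' : Type*} [Fintype κ] [Fintype κ'] {A B : StarSubalgebra ℂ (Matrix m m ℂ)}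
  {f : κ → Matrix m m ℂ} {g : κ' → Matrix m m ℂ}

theorem IsCommutantFrame.mul_idProj (hf : IsCommutantFrame A f) :
    frameMatrix f * idProj m = idProj m := by
  have h : frameMatrix f *ᵥ idVec m = idVec m := by
    ext ⟨a, b⟩
    have := congrFun (congrFun hf.sum_mul_conjTranspose a) b
    rw [Matrix.one_apply, Matrix.sum_apply] at this
    rw [idVec, ← this, frameMatrix, Matrix.sum_mulVec, Finset.sum_apply]
    refine Finset.sum_congr rfl fun k _ ↦ ?_
    simp [Matrix.mulVec, dotProduct, Fintype.sum_prod_type, idVec, Matrix.mul_apply]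
  rw [idProj, Matrix.mul_smul, Matrix.mul_vecMulVec, h]

theorem IsCommutantFrame.idProj_mul (hf : IsCommutantFrame A f) :
    idProj m * frameMatrix f = idProj m := by
  have := congrArg Matrix.conjTranspose hf.mul_idProj
  rwa [Matrix.conjTranspose_mul, hf.isHermitian.eq, isHermitian_idProj.eq] at this

theorem IsCommutantFrame.trace_frameMatrix (hf : IsCommutantFrame A f) :
    (frameMatrix f).trace = Fintype.card m := by
  rw [← hf.sum_trace, frameMatrix, Matrix.trace_sum]
  simp only [Matrix.trace_kronecker, trace_map_star]

/-- Complementarity of subalgebras is statistical independence with respect to the normalized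
trace. -/
theorem Complementary.trace_mul [Nonempty m] (h : Complementary A B) {a b : Matrix m m ℂ}
    (ha : a ∈ A) (hb : b ∈ B) :
    (a * b).trace = (Fintype.card m : ℂ)⁻¹ * (a.trace * b.trace) := by
  have hm : (Fintype.card m : ℂ) ≠ 0 := Nat.cast_ne_zero.2 Fintype.card_ne_zero
  have tr0 : ∀ x : Matrix m m ℂ,
      (x - ((Fintype.card m : ℂ)⁻¹ * x.trace) • (1 : Matrix m m ℂ)).trace = 0 := fun x ↦ by
    rw [Matrix.trace_sub, Matrix.trace_smul, Matrix.trace_one, smul_eq_mul]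
    field_simp
    ring
  have h0 := h _ (star_mem (sub_mem ha (A.smul_mem (one_mem A) ((Fintype.card m : ℂ)⁻¹ * a.trace))))
    _ (sub_mem hb (B.smul_mem (one_mem B) ((Fintype.card m : ℂ)⁻¹ * b.trace)))
    (by rw [Matrix.star_eq_conjTranspose, Matrix.trace_conjTranspose, tr0, star_zero]) (tr0 b)
  rw [Matrix.star_eq_conjTranspose, Matrix.conjTranspose_conjTranspose] at h0
  simp only [sub_mul, mul_sub, Matrix.smul_mul, Matrix.mul_smul, mul_one, one_mul,
    Matrix.trace_sub, Matrix.trace_smul, Matrix.trace_one, smul_eq_mul] at h0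
  field_simp at h0 ⊢
  linear_combination h0

/-- The projections `P`, `Q` onto the commutants of complementary subalgebras satisfy
`Tr (P Q) = 1`. -/
theorem IsCommutantFrame.trace_mul_frameMatrix [Nonempty m] (hf : IsCommutantFrame A f)
    (hg : IsCommutantFrame B g) (h : Complementary A B) :
    (frameMatrix f * frameMatrix g).trace = 1 := by
  have hm : (Fintype.card m : ℂ) ≠ 0 := Nat.cast_ne_zero.2 Fintype.card_ne_zero
  have key : ∀ k l, ((f k ⊗ₖ (f k).map star) * (g l ⊗ₖ (g l).map star)).trace
      = ((Fintype.card m : ℂ)⁻¹ * (Fintype.card m : ℂ)⁻¹)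
        * (((f k).trace * star (f k).trace) * ((g l).trace * star (g l).trace)) := fun k l ↦ by
    rw [← Matrix.mul_kronecker_mul, ← map_star_mul, Matrix.trace_kronecker, trace_map_star,
      h.trace_mul (hf.mem k) (hg.mem l)]
    simp only [star_mul', star_inv₀, star_natCast]
    ring
  rw [frameMatrix, frameMatrix, Finset.sum_mul_sum]
  simp only [Matrix.trace_sum, key]
  simp only [← Finset.mul_sum]
  rw [← Finset.sum_mul, hf.sum_trace, hg.sum_trace]
  field_simp

/-- Orthogonal projections `P`, `Q` with `Tr (P Q) = 0` are orthogonal to each other. -/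
theorem mul_eq_zero_of_trace_mul_eq_zero {κ : Type*} [Fintype κ] {P Q : Matrix κ κ ℂ}
    (hP : P.IsHermitian) (hQ : Q.IsHermitian) (hP' : P * P = P) (hQ' : Q * Q = Q)
    (h : (P * Q).trace = 0) : P * Q = 0 := by
  rw [← Matrix.trace_conjTranspose_mul_self_eq_zero_iff, Matrix.conjTranspose_mul, hP.eq, hQ.eq,
    Matrix.trace_mul_comm, mul_assoc, ← mul_assoc Q, hQ', ← mul_assoc, Matrix.trace_mul_comm,
    ← mul_assoc, hP', h]

theorem posSemidef_of_projection {κ : Type*} [Fintype κ] {P : Matrix κ κ ℂ}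
    (hP : P.IsHermitian) (hP' : P * P = P) : P.PosSemidef := by
  have := Matrix.posSemidef_conjTranspose_mul_self P
  rwa [hP.eq, hP'] at this

/-- A combination of mutually orthogonal nonzero projections is positive semidefinite iff its
coefficients are nonnegative. -/
theorem posSemidef_sum_smul_projection_iff {κ ι : Type*} [Fintype κ] [Fintype ι]
    {R : ι → Matrix κ κ ℂ} (hR : ∀ i, (R i).IsHermitian) (hR' : ∀ i, R i * R i = R i)
    (horth : Pairwise fun i j ↦ R i * R j = 0) (h0 : ∀ i, R i ≠ 0) (t : ι → ℝ) :
    (∑ i, (t i : ℂ) • R i).PosSemidef ↔ ∀ i, 0 ≤ t i := by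
  classical
  refine ⟨fun h i ↦ ?_, fun h ↦ ?_⟩
  · have h1 : (R i)ᴴ * (∑ j, (t j : ℂ) • R j) * R i = (t i : ℂ) • R i := by
      rw [(hR i).eq, Finset.mul_sum, Finset.sum_mul, Finset.sum_eq_single i]
      · rw [Matrix.mul_smul, Matrix.smul_mul, hR', hR']
      · intro j _ hj
        rw [Matrix.mul_smul, horth (Ne.symm hj), smul_zero, zero_mul]
      · simp
    have h2 := (h.conjTranspose_mul_mul_same (R i)).trace_nonneg
    rw [h1, Matrix.trace_smul, smul_eq_mul] at h2
    have h3 := posSemidef_of_projection (hR i) (hR' i)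
    have h4 : 0 < (R i).trace :=
      lt_of_le_of_ne h3.trace_nonneg fun e ↦ h0 i (h3.trace_eq_zero_iff.1 e.symm)
    have h5 : (0 : ℂ) ≤ t i := le_of_mul_le_mul_right (by rwa [zero_mul]) h4
    exact_mod_cast h5
  · have h1 : ∀ i, (0 : ℂ) ≤ t i := fun i ↦ by exact_mod_cast h i
    exact Matrix.posSemidef_sum _ fun i _ ↦ (posSemidef_of_projection (hR i) (hR' i)).smul (h1 i)

end Projections

/-! ### The Choi matrix of a generalized Pauli channel -/

section PauliMap

variable {m ι κ : Type*} [Fintype m] [DecidableEq m] [Fintype κ]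
  {A : ι → StarSubalgebra ℂ (Matrix m m ℂ)} {f : ι → κ → Matrix m m ℂ}

theorem choi_pauliMap [Fintype ι] (hf : ∀ i, IsCommutantFrame (A i) (f i)) (c : ι → ℝ) :
    choi (pauliMap A c) = ((1 - ∑ i, (c i : ℂ)) / (Fintype.card m : ℂ)) • 1
      + ∑ i, (c i : ℂ) • frameMatrix (f i) := by
  ext ⟨a, b⟩ ⟨x, d⟩
  have h : ∀ i, condExp (A i) (Matrix.single b d 1) a x = frameMatrix (f i) (a, b) (x, d) :=
    fun i ↦ by rw [← (hf i).choi_condExp, choi_apply]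
  rw [choi_apply, pauliMap]
  simp only [LinearMap.add_apply, LinearMap.smul_apply, LinearMap.smulRight_apply,
    Matrix.traceLinearMap_apply, LinearMap.sum_apply, Matrix.add_apply, Matrix.smul_apply,
    Matrix.sum_apply, h]
  congr 2
  by_cases hbd : b = d
  · subst hbd; simp [Matrix.one_apply]
  · simp [Matrix.one_apply, hbd, Matrix.trace_single_eq_of_ne]

/-- The mutually orthogonal projections that diagonalize the Choi matrix: the projection onto the
multiples of `I`, and for each `i` the projection onto the part of trace zero of the commutant
of `A i`. -/
noncomputable def commutantProj (f : ι → κ → Matrix m m ℂ) :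
    Option ι → Matrix (m × m) (m × m) ℂ
  | none => idProj m
  | some i => frameMatrix (f i) - idProj m

theorem isHermitian_commutantProj (hf : ∀ i, IsCommutantFrame (A i) (f i)) (o : Option ι) :
    (commutantProj f o).IsHermitian := by
  cases o with
  | none => exact isHermitian_idProj
  | some i => exact (hf i).isHermitian.sub isHermitian_idProj

variable [Nonempty m]

theorem commutantProj_mul_self (hf : ∀ i, IsCommutantFrame (A i) (f i)) (o : Option ι) :
    commutantProj f o * commutantProj f o = commutantProj f o := by
  cases o with
  | none => exact idProj_mul_self
  | some i =>
    simp only [commutantProj, sub_mul, mul_sub, (hf i).mul_self, (hf i).mul_idProj,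
      (hf i).idProj_mul, idProj_mul_self, sub_self, sub_zero]

theorem commutantProj_mul (hf : ∀ i, IsCommutantFrame (A i) (f i))
    (hc : Pairwise fun i j ↦ Complementary (A i) (A j)) :
    Pairwise fun o o' ↦ commutantProj f o * commutantProj f o' = 0 := by
  intro o o' ho
  cases o with
  | none =>
    cases o' with
    | none => exact absurd rfl ho
    | some j => simp only [commutantProj, mul_sub, (hf j).idProj_mul, idProj_mul_self, sub_self]
  | some i =>
    cases o' with
    | none => simp only [commutantProj, sub_mul, (hf i).mul_idProj, idProj_mul_self, sub_self]
    | some j =>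
      refine mul_eq_zero_of_trace_mul_eq_zero (isHermitian_commutantProj hf _)
        (isHermitian_commutantProj hf _) (commutantProj_mul_self hf _)
        (commutantProj_mul_self hf _) ?_
      simp only [commutantProj, sub_mul, mul_sub, (hf i).mul_idProj, (hf j).idProj_mul,
        idProj_mul_self, sub_self, sub_zero, Matrix.trace_sub, trace_idProj,
        (hf i).trace_mul_frameMatrix (hf j) (hc fun e ↦ ho (congrArg some e))]

/-- With `N + 1` subalgebras the projections `commutantProj` exhaust the space, since their traces
add up to `1 + (N + 1) (N - 1) = N ^ 2`. -/
theorem sum_commutantProj [Fintype ι] (hf : ∀ i, IsCommutantFrame (A i) (f i))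
    (hc : Pairwise fun i j ↦ Complementary (A i) (A j))
    (hcard : Fintype.card ι = Fintype.card m + 1) : ∑ o, commutantProj f o = 1 := by
  classical
  have hherm : (∑ o, commutantProj f o)ᴴ = ∑ o, commutantProj f o := by
    rw [Matrix.conjTranspose_sum]
    exact Finset.sum_congr rfl fun o _ ↦ (isHermitian_commutantProj hf o).eq
  have hidem : (∑ o, commutantProj f o) * (∑ o, commutantProj f o) = ∑ o, commutantProj f o := by
    rw [Finset.sum_mul_sum]
    refine Finset.sum_congr rfl fun o _ ↦ ?_
    rw [Finset.sum_eq_single o (fun o' _ ho' ↦ commutantProj_mul hf hc (Ne.symm ho')) (by simp),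
      commutantProj_mul_self hf]
  have htrace : (∑ o, commutantProj f o).trace = (1 : Matrix (m × m) (m × m) ℂ).trace := by
    rw [Matrix.trace_sum, Fintype.sum_option]
    simp only [commutantProj, Matrix.trace_sub, (hf _).trace_frameMatrix, trace_idProj,
      Finset.sum_const, Finset.card_univ, hcard, nsmul_eq_mul, Matrix.trace_one,
      Fintype.card_prod, Nat.cast_mul, Nat.cast_add, Nat.cast_one]
    ring
  have h0 : (1 - ∑ o, commutantProj f o)ᴴ * (1 - ∑ o, commutantProj f o)
      = 1 - ∑ o, commutantProj f o := by
    rw [Matrix.conjTranspose_sub, Matrix.conjTranspose_one, hherm, mul_sub, sub_mul, sub_mul,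
      hidem]
    simp
  have h1 : 1 - ∑ o, commutantProj f o = 0 := by
    rw [← Matrix.trace_conjTranspose_mul_self_eq_zero_iff, h0, Matrix.trace_sub, htrace, sub_self]
  exact (sub_eq_zero.1 h1).symm

theorem commutantProj_ne_zero (hf : ∀ i, IsCommutantFrame (A i) (f i)) (hm : 2 ≤ Fintype.card m)
    (o : Option ι) : commutantProj f o ≠ 0 := by
  intro h
  have h1 := congrArg Matrix.trace h
  cases o with
  | none => simp [commutantProj, trace_idProj] at h1
  | some i =>
    rw [commutantProj, Matrix.trace_sub, (hf i).trace_frameMatrix, trace_idProj, Matrix.trace_zero,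
      sub_eq_zero] at h1
    norm_cast at h1
    omega

/-- The spectral decomposition of the Choi matrix of a generalized Pauli channel. -/
theorem choi_pauliMap_eq_sum [Fintype ι] (hf : ∀ i, IsCommutantFrame (A i) (f i))
    (hc : Pairwise fun i j ↦ Complementary (A i) (A j))
    (hcard : Fintype.card ι = Fintype.card m + 1) (c : ι → ℝ) :
    choi (pauliMap A c) = ∑ o : Option ι,
      (((1 - ∑ j, c j) / Fintype.card m + o.elim (∑ j, c j) c : ℝ) : ℂ) • commutantProj f o := by
  rw [choi_pauliMap hf, ← sum_commutantProj hf hc hcard]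
  have h : ∑ i, (c i : ℂ) • frameMatrix (f i)
      = ∑ o : Option ι, ((o.elim (∑ j, c j) c : ℝ) : ℂ) • commutantProj f o := by
    rw [Fintype.sum_option]
    simp only [Option.elim, commutantProj, smul_sub, Finset.sum_sub_distrib, ← Finset.sum_smul,
      Complex.ofReal_sum]
    abel
  rw [h, Finset.smul_sum, ← Finset.sum_add_distrib]
  refine Finset.sum_congr rfl fun o _ ↦ ?_
  rw [← add_smul]
  push_cast
  rfl

theorem isCompletelyPositive_pauliMap_iff [Fintype ι] (hf : ∀ i, IsCommutantFrame (A i) (f i))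
    (hc : Pairwise fun i j ↦ Complementary (A i) (A j))
    (hcard : Fintype.card ι = Fintype.card m + 1) (hm : 2 ≤ Fintype.card m) (c : ι → ℝ) :
    IsCompletelyPositive (pauliMap A c) ↔
      0 ≤ (1 - ∑ j, c j) / Fintype.card m + ∑ j, c j ∧
        ∀ i, 0 ≤ (1 - ∑ j, c j) / Fintype.card m + c i := by
  rw [isCompletelyPositive_iff_posSemidef_choi, choi_pauliMap_eq_sum hf hc hcard,
    posSemidef_sum_smul_projection_iff (isHermitian_commutantProj hf) (commutantProj_mul_self hf)
      (commutantProj_mul hf hc) (commutantProj_ne_zero hf hm), Option.forall]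
  rfl

end PauliMap

end PauliChannel

theorem theorem3p2 (n : ℕ) (hn : 2 ≤ n)
    (A : Fin (n ^ 2 + 1) → StarSubalgebra ℂ (Matrix (Fin n × Fin n) (Fin n × Fin n) ℂ))
    (hFM : ∀ i, PauliChannel.IsFSubalgebra (A i) ∨ PauliChannel.IsMSubalgebra (A i))
    (hcompl : Pairwise fun i j ↦ PauliChannel.Complementary (A i) (A j))
    (hspan : ⨆ i, Subalgebra.toSubmodule (A i).toSubalgebra = ⊤)
    (c : Fin (n ^ 2 + 1) → ℝ) :
    PauliChannel.IsCompletelyPositive (PauliChannel.pauliMap A c) ↔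
      ∀ i, ∑ j, c j ≤ 1 + (n : ℝ) ^ 2 * c i ∧ -1 / ((n : ℝ) ^ 2 - 1) ≤ ∑ j, c j := by
  have hcard : Fintype.card (Fin n × Fin n) = n ^ 2 := by
    rw [Fintype.card_prod, Fintype.card_fin, sq]
  have h4 : 4 ≤ n ^ 2 := by nlinarith
  have : Nonempty (Fin n × Fin n) := Fintype.card_pos_iff.1 (by omega)
  have hframe : ∀ i, ∃ f : Fin n × Fin n → Matrix (Fin n × Fin n) (Fin n × Fin n) ℂ,
      PauliChannel.IsCommutantFrame (A i) f := fun i ↦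
    (hFM i).elim (fun h ↦ h.exists_isCommutantFrame (by omega)) fun h ↦ h.exists_isCommutantFrame
  choose f hf using hframe
  have h4' : (4 : ℝ) ≤ (n : ℝ) ^ 2 := by exact_mod_cast h4
  rw [PauliChannel.isCompletelyPositive_pauliMap_iff hf hcompl (by rw [Fintype.card_fin, hcard])
    (by omega), hcard, Nat.cast_pow]
  generalize (n : ℝ) ^ 2 = N at h4' ⊢
  generalize ∑ j, c j = s
  have hN : 0 < N := by linarith
  have e1 : 0 ≤ (1 - s) / N + s ↔ -1 / (N - 1) ≤ s := by
    rw [div_add' _ _ _ hN.ne', div_le_iff₀ (by linarith), le_div_iff₀ hN]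
    constructor <;> intro h <;> nlinarith
  have e2 : ∀ i, 0 ≤ (1 - s) / N + c i ↔ s ≤ 1 + N * c i := fun i ↦ by
    rw [div_add' _ _ _ hN.ne', le_div_iff₀ hN]
    constructor <;> intro h <;> nlinarith
  rw [forall_and, forall_const, e1, and_comm]
  simp only [e2]
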